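/- Let $G=(V,E)$ be a finite simple graph. For a bijection $f\colon V\to\{1,2,\dots,|V|\}$ and $v\in V$, let $w_f(v)=\sum_{x\in N(v)}f(x)$, where $N(v)$ is the open neighbourhood of $v$. The bijection $f$ is a local distance antimagic labeling of $G$ if $w_f(u)\neq w_f(v)$ for every edge $uv$ of $G$, and the local distance antimagic chromatic number $\chi_{ld}(G)$ is the minimum of $|\{w_f(v): v\in V\}|$ over all local distance antimagic labelings $f$ of $G$ (and $\infty$ if there are none). The lexicographic product $G[H]$ is the graph on $V(G)\times V(H)$ in which $(g,h)$ and $(g',h')$ are adjacent if and only if $gg'\in E(G)$, or $g=g'$ and $hh'\in E(H)$. For all integers $m\ge 5$ odd and $n\ge 3$, the lexicographic product $C_m[\overline{K_n}]$ of the cycle $C_m$ on $m$ vertices with the complement of the complete graph on $n$ vertices (the graph on $n$ vertices without edges) satisfies $$\chi_{ld}\bigl(C_m[\overline{K_n}]\bigr)=3.$$ -/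

import Mathlib

namespace SimpleGraph

/-- The lexicographic product `G[H]`: `(a, x)` and `(b, y)` are adjacent when `a` and `b` are
adjacent in `G`, or when `a = b` and `x` and `y` are adjacent in `H`. -/
def lexProduct {V W : Type*} (G : SimpleGraph V) (H : SimpleGraph W) : SimpleGraph (V × W) where
  Adj p q := G.Adj p.1 q.1 ∨ (p.1 = q.1 ∧ H.Adj p.2 q.2)
  symm := ⟨fun _ _ h => h.elim (fun h => Or.inl h.symm) (fun h => Or.inr ⟨h.1.symm, h.2.symm⟩)⟩
  loopless := ⟨fun _ h => h.elim (fun h => G.irrefl h) (fun h => H.irrefl h.2)⟩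

instance lexProductDecidableAdj {V W : Type*} (G : SimpleGraph V) (H : SimpleGraph W)
    [DecidableEq V] [DecidableRel G.Adj] [DecidableRel H.Adj] :
    DecidableRel (lexProduct G H).Adj :=
  fun p q => inferInstanceAs (Decidable (G.Adj p.1 q.1 ∨ (p.1 = q.1 ∧ H.Adj p.2 q.2)))

section

variable {V : Type*} [Fintype V] (G : SimpleGraph V) [DecidableRel G.Adj]

/-- The weight of `v` under the labeling `f`: the sum of the labels in its open neighborhood. -/
def distanceWeight (f : V → ℕ) (v : V) : ℕ :=
  ∑ x ∈ G.neighborFinset v, f x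

/-- `f` is a bijection from the vertex set onto `{1, …, |V|}`, and adjacent vertices have
distinct weights. -/
structure IsLocalDistanceAntimagic (f : V → ℕ) : Prop where
  bijOn : Set.BijOn f Set.univ (Set.Icc 1 (Fintype.card V))
  weight_ne : ∀ u v : V, G.Adj u v → G.distanceWeight f u ≠ G.distanceWeight f v

/-- The local distance antimagic chromatic number: the minimum, over all local distance antimagic
labelings, of the number of distinct weights (and `⊤` if there is no such labeling). -/
noncomputable def localDistanceAntimagicChromaticNumber : ℕ∞ :=
  ⨅ (f : V → ℕ) (_ : G.IsLocalDistanceAntimagic f), (Set.range (G.distanceWeight f)).encard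

end

end SimpleGraph

namespace SimpleGraph

section General

variable {V W : Type*} [Fintype V] [Fintype W]

/-! Lower bound: the weights of a local distance antimagic labeling form a proper coloring, and the
product contains a copy of the odd cycle, whose chromatic number is 3. Upper bound: every weight is
the sum of the two neighboring block sums. If block `j` has sum `D + d j` with `d` running through
0, 1, -1, 0 periodically (`d j = swapMiddle j - j`), the weights alternate between `2 D + 1` and `2
D - 1`, except for a single `2 D` where the odd cycle closes up. `exists_rows_sum_eq_swapMiddle`
supplies such blocks and `bijOn_stack_rows` turns them into a labeling. -/

theorem chromaticNumber_le_localDistanceAntimagicChromaticNumber (G : SimpleGraph V)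
    [DecidableRel G.Adj] :
    G.chromaticNumber ≤ G.localDistanceAntimagicChromaticNumber := by
  refine le_iInf₂ fun f hf => ?_
  have hfin : (Set.range (G.distanceWeight f)).Finite := Set.finite_range _
  have := hfin.fintype
  let C : G.Coloring (Set.range (G.distanceWeight f)) :=
    Coloring.mk (fun v => ⟨G.distanceWeight f v, v, rfl⟩)
      (fun h e => hf.weight_ne _ _ h (congrArg Subtype.val e))
  have h := C.colorable.chromaticNumber_le
  rwa [← Nat.card_eq_fintype_card, Nat.card_coe_set_eq, hfin.cast_ncard_eq] at h

/-- The copy of `G` inside `G[H]` at a fixed vertex of `H`. -/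
def lexProductLeftHom (G : SimpleGraph V) (H : SimpleGraph W) (w : W) : G →g lexProduct G H where
  toFun v := (v, w)
  map_rel' h := Or.inl h

theorem distanceWeight_lexProduct_bot (G : SimpleGraph V) (H : SimpleGraph W)
    [DecidableRel G.Adj] [DecidableRel (lexProduct G H).Adj] (hH : H = ⊥) (f : V × W → ℕ)
    (p : V × W) :
    (lexProduct G H).distanceWeight f p = ∑ u ∈ G.neighborFinset p.1, ∑ y, f (u, y) := by
  have : (lexProduct G H).neighborFinset p = G.neighborFinset p.1 ×ˢ Finset.univ := by
    ext q
    rw [mem_neighborFinset]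
    simp [lexProduct, hH]
  rw [distanceWeight, this, Finset.sum_product]

end General

/-- The involution of `ℕ` exchanging `4 q + 1` and `4 q + 2` for every `q`. -/
def swapMiddle (i : ℕ) : ℕ :=
  if i % 4 = 1 then i + 1 else if i % 4 = 2 then i - 1 else i

theorem swapMiddle_lt {m i : ℕ} (hm : Odd m) (hi : i < m) : swapMiddle i < m := by
  obtain ⟨k, rfl⟩ := hm
  unfold swapMiddle
  split_ifs <;> omega

theorem swapMiddle_injective : Function.Injective swapMiddle := by
  intro i j h
  unfold swapMiddle at h
  split_ifs at h <;> omega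

/-- For odd `m` and `n ≥ 2` there is an `n × m` array whose rows are permutations of
`{0, …, m - 1}` and whose column sums are, up to a constant, `swapMiddle i - i`. -/
theorem exists_rows_sum_eq_swapMiddle {m : ℕ} (hm : Odd m) :
    ∀ n : ℕ, ∃ (g : ℕ → ℕ → ℕ) (C : ℕ),
      (∀ r, ∀ i < m, g r i < m) ∧ (∀ r, ∀ i < m, ∀ j < m, g r i = g r j → i = j) ∧
      ∀ i < m, (∑ r ∈ Finset.range (n + 2), g r i) + i = C + swapMiddle i
  | 0 => by
    refine ⟨fun r i => if r = 0 then swapMiddle i else m - 1 - i, m - 1, fun r i hi => ?_,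
      fun r i hi j hj h => ?_, fun i hi => ?_⟩
    · have := swapMiddle_lt hm hi
      grind
    · by_cases hr : r = 0
      · exact swapMiddle_injective (by simpa [hr] using h)
      · simp only [hr, if_false] at h
        omega
    · simp [Finset.sum_range_succ]
      omega
  | 1 => by
    obtain ⟨k, hk⟩ := id hm
    -- With `m = 2 k + 1`, the last two rows are `i + k` and `2 k - 2 i` modulo `m`, the latter a
    -- permutation because `m` is odd. They add up to `3 k - i` without wraparound.
    refine ⟨fun r i => if r = 0 then swapMiddle i
      else if r = 1 then (if i ≤ k then i + k else i - (k + 1))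
      else (if i ≤ k then 2 * k - 2 * i else 4 * k + 1 - 2 * i), 3 * k, fun r i hi => ?_,
      fun r i hi j hj h => ?_, fun i hi => ?_⟩
    · have := swapMiddle_lt hm hi
      grind
    · by_cases hr : r = 0
      · exact swapMiddle_injective (by simpa [hr] using h)
      · simp only [hr, if_false] at h
        split_ifs at h <;> omega
    · simp [Finset.sum_range_succ]
      split_ifs <;> omega
  | n + 2 => by
    obtain ⟨g, C, hlt, hinj, hsum⟩ := exists_rows_sum_eq_swapMiddle hm n
    -- The identity and its reversal add `m - 1` to every column.
    refine ⟨fun r i => if r < n + 2 then g r i else if r = n + 2 then i else m - 1 - i,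
      C + (m - 1), fun r i hi => ?_, fun r i hi j hj h => ?_, fun i hi => ?_⟩
    · have := hlt r i hi
      grind
    · by_cases hr : r < n + 2
      · exact hinj r i hi j hj (by simpa [hr] using h)
      · simp only [hr, if_false] at h
        split_ifs at h <;> omega
    · have h : ∑ r ∈ Finset.range (n + 2),
          (if r < n + 2 then g r i else if r = n + 2 then i else m - 1 - i) =
          ∑ r ∈ Finset.range (n + 2), g r i :=
        Finset.sum_congr rfl fun r hr => if_pos (Finset.mem_range.mp hr)
      have := hsum i hi
      rw [Finset.sum_range_succ, Finset.sum_range_succ, h]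
      simp
      omega

/-- Stacking `n` rows that are permutations of `{0, …, m - 1}` labels `Fin m × Fin n`
bijectively by `1, …, m n`. -/
theorem bijOn_stack_rows {m n : ℕ} (g : ℕ → ℕ → ℕ) (hlt : ∀ r, ∀ i < m, g r i < m)
    (hinj : ∀ r, ∀ i < m, ∀ j < m, g r i = g r j → i = j) :
    Set.BijOn (fun p : Fin m × Fin n => p.2.val * m + g p.2 p.1 + 1) Set.univ
      (Set.Icc 1 (Fintype.card (Fin m × Fin n))) := by
  have hmaps : Set.MapsTo (fun p : Fin m × Fin n => p.2.val * m + g p.2 p.1 + 1) Set.univ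
      (Set.Icc 1 (Fintype.card (Fin m × Fin n))) := by
    rintro ⟨i, r⟩ -
    have h₁ := hlt r i i.2
    have h₂ : (r.val + 1) * m ≤ n * m := Nat.mul_le_mul_right m r.2
    simp only [Fintype.card_prod, Fintype.card_fin, Set.mem_Icc]
    rw [mul_comm m n]
    exact ⟨Nat.le_add_left 1 _, by linarith⟩
  have hinjOn : Function.Injective (fun p : Fin m × Fin n => p.2.val * m + g p.2 p.1 + 1) := by
    rintro ⟨i, r⟩ ⟨j, s⟩ h
    have h₁ := hlt r i i.2
    have h₂ := hlt s j j.2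
    have h₃ : g r i + m * r.val = g s j + m * s.val := by
      simp only at h
      linarith
    have hrs : r.val = s.val := by
      have := congrArg (· / m) h₃
      have hm : 0 < m := by omega
      simpa [Nat.add_mul_div_left _ _ hm, Nat.div_eq_of_lt h₁, Nat.div_eq_of_lt h₂] using this
    have hij : i.val = j.val := by
      rw [hrs] at h₃ h₁
      exact hinj s i i.2 j j.2 (by omega)
    simp [Fin.ext_iff, hrs, hij]
  refine ⟨hmaps, hinjOn.injOn, ?_⟩
  have h := Finset.surjOn_of_injOn_of_card_le (s := Finset.univ)
    (t := Finset.Icc 1 (Fintype.card (Fin m × Fin n)))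
    (fun p : Fin m × Fin n => p.2.val * m + g p.2 p.1 + 1)
    (by rwa [Finset.coe_univ, Finset.coe_Icc]) hinjOn.injOn (by simp)
  rwa [Finset.coe_univ, Finset.coe_Icc] at h

/-- The proper coloring of the odd cycle, alternating between `0` and `2` except for one vertex
of color `1`, that the weights of the labeling realize. -/
def weightColor (m i : ℕ) : ℕ :=
  if (m % 4 = 1 ∧ i + 1 = m) ∨ (m % 4 = 3 ∧ i = 0) then 1 else if i % 2 = 1 then 0 else 2

theorem weightColor_mem (m i : ℕ) : weightColor m i ∈ ({0, 1, 2} : Set ℕ) := by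
  unfold weightColor
  split_ifs <;> simp

theorem val_add_one_cyclic {k : ℕ} (i : Fin (k + 3)) :
    (i + 1).val = if i.val + 1 = k + 3 then 0 else i.val + 1 := by
  have := i.2
  rw [Fin.val_add_one]
  simp only [Fin.ext_iff, Fin.val_last]
  split_ifs <;> omega

theorem val_sub_one_cyclic {k : ℕ} (i : Fin (k + 3)) :
    (i - 1).val = if i.val = 0 then k + 2 else i.val - 1 := by
  have := val_add_one_cyclic (i - 1)
  rw [sub_add_cancel] at this
  have := (i - 1).2
  grind

/-- Parity alternates except across the edge joining the last vertex to 0, both even; the vertex of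
color 1 is an end of that edge. -/
theorem weightColor_ne {k : ℕ} (hk : Odd (k + 3)) {i j : Fin (k + 3)}
    (h : (cycleGraph (k + 3)).Adj i j) : weightColor (k + 3) i ≠ weightColor (k + 3) j := by
  obtain ⟨l, hl⟩ := hk
  have key : ∀ a : Fin (k + 3), weightColor (k + 3) a ≠ weightColor (k + 3) (a + 1 : Fin _) := by
    intro a
    have := a.2
    rw [val_add_one_cyclic]
    unfold weightColor
    grind
  rcases cycleGraph_adj.mp h with h | h
  · rw [sub_eq_iff_eq_add'.mp h]
    exact (key j).symm
  · rw [sub_eq_iff_eq_add'.mp h]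
    exact key i

/-- If the blocks of an odd cycle have sums `D + swapMiddle j - j`, then the sums over the
neighborhoods are `2 D - 1` plus the color of the vertex. -/
theorem sum_neighborFinset_add_one {k D : ℕ} (hk : Odd (k + 3)) (S : Fin (k + 3) → ℕ)
    (hS : ∀ j, S j + j.val = D + swapMiddle j.val) (i : Fin (k + 3)) :
    ∑ j ∈ (cycleGraph (k + 3)).neighborFinset i, S j + 1 = 2 * D + weightColor (k + 3) i := by
  obtain ⟨l, hl⟩ := hk
  -- The neighborhood is a genuine pair because the cycle has at least 3 vertices.
  have hne : i - 1 ≠ i + 1 := by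
    intro h
    have := congrArg Fin.val h
    rw [val_add_one_cyclic, val_sub_one_cyclic] at this
    have := i.2
    split_ifs at * <;> omega
  rw [cycleGraph_neighborFinset, Finset.sum_pair hne]
  have h₁ := hS (i - 1)
  have h₂ := hS (i + 1)
  have := i.2
  rw [val_sub_one_cyclic] at h₁
  rw [val_add_one_cyclic] at h₂
  unfold swapMiddle at h₁ h₂
  unfold weightColor
  grind

/-- Taking `H` with `H = ⊥` lets the complement of the complete graph be used with its own
decidability instance. -/
theorem exists_isLocalDistanceAntimagic {k n : ℕ} (hk : Odd (k + 3)) (H : SimpleGraph (Fin (n + 2)))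
    [DecidableRel (lexProduct (cycleGraph (k + 3)) H).Adj] (hH : H = ⊥) :
    ∃ f, (lexProduct (cycleGraph (k + 3)) H).IsLocalDistanceAntimagic f ∧
      (Set.range ((lexProduct (cycleGraph (k + 3)) H).distanceWeight f)).encard ≤ 3 := by
  obtain ⟨g, C, hlt, hinj, hsum⟩ := exists_rows_sum_eq_swapMiddle hk n
  let f : Fin (k + 3) × Fin (n + 2) → ℕ := fun p => p.2.val * (k + 3) + g p.2 p.1 + 1
  let D := ∑ r : Fin (n + 2), (r.val * (k + 3) + 1) + C
  have hS : ∀ j : Fin (k + 3), ∑ r, f (j, r) + j.val = D + swapMiddle j.val := by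
    intro j
    have h : ∑ r, f (j, r) = ∑ r : Fin (n + 2), (r.val * (k + 3) + 1) +
        ∑ r ∈ Finset.range (n + 2), g r j := by
      rw [← Fin.sum_univ_eq_sum_range (fun r => g r j), ← Finset.sum_add_distrib]
      exact Finset.sum_congr rfl fun r _ => by simp only [f]; ring
    rw [h, add_assoc, hsum j j.2, ← add_assoc]
  have hw : ∀ p, (lexProduct (cycleGraph (k + 3)) H).distanceWeight f p + 1 =
      2 * D + weightColor (k + 3) p.1 := by
    intro p
    rw [distanceWeight_lexProduct_bot _ _ hH, ← sum_neighborFinset_add_one hk _ hS]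
  refine ⟨f, ⟨bijOn_stack_rows g hlt hinj, fun u v huv he => ?_⟩, ?_⟩
  · have huv' : (cycleGraph (k + 3)).Adj u.1 v.1 := by simpa [lexProduct, hH] using huv
    have := hw u
    have := hw v
    exact weightColor_ne hk huv' (by omega)
  · have hsub : Set.range ((lexProduct (cycleGraph (k + 3)) H).distanceWeight f) ⊆
        (fun c => 2 * D + c - 1) '' {0, 1, 2} := by
      rintro _ ⟨p, rfl⟩
      have := hw p
      exact ⟨_, weightColor_mem (k + 3) p.1, by simp only; omega⟩
    refine (Set.encard_le_encard hsub).trans ((Set.encard_image_le _ _).trans ?_)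
    have := Set.encard_insert_le ({1, 2} : Set ℕ) 0
    rw [Set.encard_pair (by norm_num)] at this
    exact this.trans (by norm_num)

end SimpleGraph

theorem mainTheorem9 (m n : ℕ) (hm : 5 ≤ m) (hodd : Odd m) (hn : 3 ≤ n) :
    (SimpleGraph.lexProduct (SimpleGraph.cycleGraph m)
      (SimpleGraph.completeGraph (Fin n))ᶜ).localDistanceAntimagicChromaticNumber = 3 := by
  obtain ⟨k, rfl⟩ : ∃ k, m = k + 3 := ⟨m - 3, by omega⟩
  obtain ⟨n, rfl⟩ : ∃ l, n = l + 2 := ⟨n - 2, by omega⟩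
  apply le_antisymm
  · obtain ⟨f, hf, hcard⟩ := SimpleGraph.exists_isLocalDistanceAntimagic hodd
      (SimpleGraph.completeGraph (Fin (n + 2)))ᶜ compl_top
    exact (iInf₂_le f hf).trans hcard
  · rw [← SimpleGraph.chromaticNumber_cycleGraph_of_odd (k + 3) (by omega) hodd]
    exact (SimpleGraph.chromaticNumber_mono_of_hom
      (SimpleGraph.lexProductLeftHom _ _ 0)).trans
      (SimpleGraph.chromaticNumber_le_localDistanceAntimagicChromaticNumber _)
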